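/- Let $p$ be a prime, let $\mathcal{O}$ be the valuation ring of a finite extension of $\mathbb{Q}_p$, with uniformizer $\varpi$, and let $\Gamma$ be a topological group isomorphic to $\mathbb{Z}_p$, with a chosen topological generator $\gamma$. Identify the Iwasawa algebra $\Lambda_{\mathcal{O}}$ of $\Gamma$ over $\mathcal{O}$ with $\mathcal{O}[[T]]$ by $T=\gamma-1$, so that $\gamma^a$ acts as $(1+T)^a$ for $a\in\mathbb{Z}_p$. Let $\mathcal{D}$ be a discrete $p$-primary $\Lambda_{\mathcal{O}}$-module whose Pontryagin dual $\mathcal{D}^\vee=\operatorname{Hom}_{\mathbb{Z}_p}(\mathcal{D},\mathbb{Q}_p/\mathbb{Z}_p)$ is a finitely generated torsion $\Lambda_{\mathcal{O}}$-module (i.e. $\mathcal{D}$ is cofinitely generated and cotorsion). There is a homomorphism of $\Lambda_{\mathcal{O}}$-modules with finite kernel and cokernel $$\mathcal{D}^\vee\longrightarrow \bigoplus_{i=1}^{s}\Lambda_{\mathcal{O}}/(\varpi^{\mu_i})\ \oplus\ \bigoplus_{j=1}^{t}\Lambda_{\mathcal{O}}/(f_j^{\lambda_j}),$$ where $s,t,\mu_i,\lambda_j\ge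 0$ are integers and the $f_j\in\mathcal{O}[T]$ are irreducible distinguished polynomials (monic, with all non-leading coefficients divisible by $\varpi$). Put $\mu_p(\mathcal{D})=\sum_i\mu_i$ and $\lambda_p(\mathcal{D})=\sum_j\lambda_j\deg f_j$; these do not depend on the choices. Suppose that the Euler characteristic of $\mathcal{D}$ is well defined, i.e. that $H^0(\Gamma,\mathcal{D})$ is finite, and let $$\chi(\Gamma,\mathcal{D})=\prod_{i\ge 0}\bigl(\#H^i(\Gamma,\mathcal{D})\bigr)^{(-1)^i}=\frac{\#H^0(\Gamma,\mathcal{D})}{\#H^1(\Gamma,\mathcal{D})},$$ where $H^i(\Gamma,\mathcal{D})$ is continuous group cohomology. Then $\chi(\Gamma,\mathcal{D})=1$ if and only if $\mu_p(\mathcal{D})=0$ and $\lambda_p(\mathcal{D})=0$. -/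

import Mathlib

open scoped PowerSeries Polynomial

universe u v w

noncomputable section

namespace Iwasawa

/-! ### Pontryagin duals -/

section Dual

variable (p : ℕ) [Fact p.Prime]

/-- The `ℤ_p`-module `ℚ_p / ℤ_p`. -/
abbrev QpModZp : Type :=
  ℚ_[p] ⧸ LinearMap.range (Algebra.linearMap ℤ_[p] ℚ_[p])

/-- The Pontryagin dual `Hom_{ℤ_p}(D, ℚ_p / ℤ_p)`. -/
def Dual (D : Type*) [AddCommGroup D] [Module ℤ_[p] D] : Type _ :=
  D →ₗ[ℤ_[p]] QpModZp p

instance (D : Type*) [AddCommGroup D] [Module ℤ_[p] D] : AddCommGroup (Dual p D) :=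
  inferInstanceAs (AddCommGroup (D →ₗ[ℤ_[p]] QpModZp p))

/-- Over a `ℤ_p`-algebra `R`, the dual of an `R`-module is an `R`-module through
`(r • φ) d = φ (r • d)`. -/
instance (R D : Type*) [CommRing R] [Algebra ℤ_[p] R] [AddCommGroup D] [Module ℤ_[p] D]
    [Module R D] [IsScalarTower ℤ_[p] R D] : Module R (Dual p D) where
  smul r φ := LinearMap.comp (show D →ₗ[ℤ_[p]] QpModZp p from φ) (Algebra.lsmul ℤ_[p] ℤ_[p] D r)
  one_smul φ := LinearMap.ext fun d => congrArg
    (show D →ₗ[ℤ_[p]] QpModZp p from φ) (one_smul R d)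
  mul_smul r s φ := LinearMap.ext fun d => congrArg (show D →ₗ[ℤ_[p]] QpModZp p from φ)
    (show (r * s) • d = s • r • d by rw [mul_comm, mul_smul])
  smul_zero r := LinearMap.ext fun _ => rfl
  smul_add r φ ψ := LinearMap.ext fun _ => rfl
  add_smul r s φ := LinearMap.ext fun d =>
    (congrArg (show D →ₗ[ℤ_[p]] QpModZp p from φ) (add_smul r s d)).trans (map_add _ _ _)
  zero_smul φ := LinearMap.ext fun d =>
    (congrArg (show D →ₗ[ℤ_[p]] QpModZp p from φ) (zero_smul R d)).trans (map_zero _)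

end Dual

/-! ### Modules over the Iwasawa algebra `Λ = O⟦T⟧` -/

section Modules

variable (p : ℕ) [Fact p.Prime] (O : Type*) [CommRing O] [IsLocalRing O] [Algebra ℤ_[p] O]
  (D : Type*) [AddCommGroup D] [Module O⟦X⟧ D]

/-- `D` is a discrete `p`-primary `O⟦T⟧`-module: the annihilator of each element contains a power
of the maximal ideal of `O⟦T⟧` (that is, the action on the discrete group `D` is continuous), and
each element is killed by a power of `p`. -/
def IsDiscretePrimary : Prop :=
  (∀ d : D, ∃ n : ℕ, ∀ a ∈ IsLocalRing.maximalIdeal O⟦X⟧ ^ n, a • d = 0) ∧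
    ∀ d : D, ∃ n : ℕ, p ^ n • d = 0

variable [Module ℤ_[p] D] [IsScalarTower ℤ_[p] O⟦X⟧ D]

/-- `D` is cofinitely generated: its Pontryagin dual is finitely generated. -/
def IsCofinitelyGenerated : Prop := Module.Finite O⟦X⟧ (Dual p D)

/-- `D` is cotorsion: every element of its Pontryagin dual is killed by a nonzero element. -/
def IsCotorsion : Prop := Module.IsTorsion O⟦X⟧ (Dual p D)

end Modules

/-! ### The `μ`- and `λ`-invariants -/

section Invariants

variable {O : Type*} [CommRing O] [IsLocalRing O]

variable (O) in
/-- The exponents `μ_i`, `λ_j` and the irreducible distinguished polynomials `f_j` that describe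
an elementary torsion module over `O⟦T⟧`. -/
structure ElementaryData where
  s : ℕ
  t : ℕ
  mu : Fin s → ℕ
  lam : Fin t → ℕ
  f : Fin t → O[X]
  distinguished : ∀ j, (f j).IsDistinguishedAt (IsLocalRing.maximalIdeal O)
  irreducible : ∀ j, Irreducible (f j)

/-- The elementary module `(⨁_i Λ / (ϖ ^ μ_i)) ⊕ (⨁_j Λ / (f_j ^ λ_j))`, where `Λ = O⟦T⟧`. -/
abbrev ElementaryData.Mod (ϖ : O) (E : ElementaryData O) : Type _ :=
  (∀ i : Fin E.s, O⟦X⟧ ⧸ Ideal.span {(PowerSeries.C ϖ : O⟦X⟧) ^ E.mu i}) ×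
    (∀ j : Fin E.t, O⟦X⟧ ⧸ Ideal.span {(E.f j : O⟦X⟧) ^ E.lam j})

/-- `Σ μ_i`. -/
def ElementaryData.muSum (E : ElementaryData O) : ℕ := ∑ i, E.mu i

/-- `Σ λ_j deg f_j`. -/
def ElementaryData.lamSum (E : ElementaryData O) : ℕ := ∑ j, E.lam j * (E.f j).natDegree

variable (ϖ : O) (M : Type*) [AddCommGroup M] [Module O⟦X⟧ M]

/-- There is a homomorphism from `M` to the elementary module of `E` with finite kernel and
cokernel. -/
def IsStructure (E : ElementaryData O) : Prop :=
  ∃ φ : M →ₗ[O⟦X⟧] E.Mod ϖ, Finite (LinearMap.ker φ) ∧ Finite (E.Mod ϖ ⧸ LinearMap.range φ)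

open Classical in
/-- The `μ`-invariant `Σ μ_i` of `M`, read off from an elementary module to which `M` maps with
finite kernel and cokernel. The value does not depend on the choice; it would be `⊤` only for an
`M` without such a homomorphism, and no finitely generated torsion module is of that kind. -/
def muInvariant : ℕ∞ :=
  if h : ∃ E, IsStructure ϖ M E then (h.choose.muSum : ℕ∞) else ⊤

open Classical in
/-- The `λ`-invariant `Σ λ_j deg f_j` of `M`, with the same conventions as for `muInvariant`. -/
def lambdaInvariant : ℕ∞ :=
  if h : ∃ E, IsStructure ϖ M E then (h.choose.lamSum : ℕ∞) else ⊤

end Invariants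

/-! ### The action of `Γ` and the Euler characteristic -/

section Euler

variable {p : ℕ} [Fact p.Prime] (O : Type w) [CommRing O] [Algebra ℤ_[p] O]
  {Γ : Type v} [Group Γ] [TopologicalSpace Γ] [IsTopologicalGroup Γ]

/-- The homomorphism `Γ → O⟦T⟧`, `γ ^ a ↦ (1 + T) ^ a = Σ_n (a choose n) T ^ n` for `a ∈ ℤ_p`,
that identifies `T` with `γ - 1`. The isomorphism `e : ℤ_p ≃ Γ`, `a ↦ γ ^ a`, records the choice
of the topological generator `γ`. -/
def gammaHom (e : Multiplicative ℤ_[p] ≃ₜ* Γ) : Γ →* O⟦X⟧ where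
  toFun g := PowerSeries.binomialSeries O (e.symm g).toAdd
  map_one' := by simp
  map_mul' g h := by simp [PowerSeries.binomialSeries_add]

variable (D : Type (max u v)) [AddCommGroup D] [Module O⟦X⟧ D] [TopologicalSpace D]
  [DiscreteTopology D]

/-- The discrete module `D` as a topological representation of `Γ`. -/
def gammaRep (e : Multiplicative ℤ_[p] ≃ₜ* Γ) : TopRep.{max u v} ℤ Γ :=
  haveI : ContinuousSMul ℤ D := ⟨continuous_of_discreteTopology⟩
  TopRep.of (X := D) (ContRepresentation.ofMonoidHom
    { toFun g :=
        { toFun d := gammaHom O e g • d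
          map_add' := smul_add _
          map_smul' n d := smul_comm _ n d
          cont := continuous_of_discreteTopology }
      map_one' := by ext d; simp
      map_mul' g h := by ext d; simp [mul_smul] })

/-- The continuous cohomology group `H^i(Γ, D)`. -/
abbrev gammaCohomology (e : Multiplicative ℤ_[p] ≃ₜ* Γ) (i : ℕ) : Type (max u v) :=
  continuousCohomology i (gammaRep.{u} O D e)

/-- The Euler characteristic of `D` is well defined if `H^0(Γ, D)` is finite. -/
def EulerCharWellDefined (e : Multiplicative ℤ_[p] ≃ₜ* Γ) : Prop :=
  Finite (gammaCohomology.{u} O D e 0)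

/-- The Euler characteristic `χ(Γ, D) = ∏_{i ≥ 0} (# H^i(Γ, D)) ^ ((-1) ^ i)`. -/
def eulerChar (e : Multiplicative ℤ_[p] ≃ₜ* Γ) : ℚ :=
  ∏ᶠ i : ℕ, (Nat.card (gammaCohomology.{u} O D e i) : ℚ) ^ ((-1 : ℤ) ^ i)

end Euler

end Iwasawa

end

/-! The variable `T` acts on `D` as `γ - 1`. For a discrete `p`-primary module over `Γ ≃ ℤ_p`, `H⁰`
is the kernel of `T`, `H¹` is `D / TD`, and higher cohomology vanishes, so `χ` is `#ker T / #(D /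
TD)` (`eulerChar_eq`). Everything then turns on finiteness: `χ = 1` exactly when `D` is finite, `D`
is finite exactly when its dual is, and a module is finite exactly when both invariants vanish,
because a finite elementary module is zero.

If `D` is finite, kernel and cokernel of `T` have the same order. Conversely, the dual is
Noetherian, so the images `T ^ n D` stabilise at some `W` with `TW = W`, and `W` has finite index
because `D / TD` is finite. The snake lemma gives an exact sequence `0 → W[T] → D[T] → (D/W)[T] →
0`, and `D` and `D/W` have the same cokernel. Since `D/W` is finite, equality of orders forces `W[T]
= 0`. As `T` is locally nilpotent, `W = 0` and `D` is finite (`finite_of_nat_card_ker_eq`).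

The cohomology is computed from the resolution by iterated modules of continuous functions on `Γ`.
It is exact, and `γ - 1` is surjective on each coinduced term because functions on `ℤ_p` with values
of bounded `p`-power order have discrete antiderivatives; the rest is a diagram chase. -/

namespace Iwasawa

open CategoryTheory

/-! ### Elementwise homology of complexes of topological modules -/

section Homology

variable {R : Type*} [Ring R] [TopologicalSpace R]

/-- The homology of a short complex of topological modules is the quotient of the cycles by the
boundaries. -/
theorem exists_cycles_to_homology (S : ShortComplex (TopModuleCat R)) :
    ∃ π : LinearMap.ker S.g.hom.toLinearMap → S.homology, Function.Surjective π ∧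
      ∀ x y, π x = π y ↔ ∃ z, S.f.hom z = x.1 - y.1 := by
  let D₁ : S.LeftHomologyData := ⟨_, _, _, _, _, TopModuleCat.isLimitKer _, by simp,
    TopModuleCat.isColimitCoker _⟩
  refine ⟨fun x => D₁.homologyIso.inv.hom (D₁.π.hom x), ?_, ?_⟩
  · refine Function.Surjective.comp (g := D₁.homologyIso.inv.hom) ?_ (Submodule.mkQ_surjective _)
    intro y
    exact ⟨D₁.homologyIso.hom.hom y, ConcreteCategory.congr_hom D₁.homologyIso.hom_inv_id y⟩
  · intro x y
    have hinj : Function.Injective D₁.homologyIso.inv.hom :=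
      Function.LeftInverse.injective (g := D₁.homologyIso.hom.hom)
        fun y => ConcreteCategory.congr_hom D₁.homologyIso.inv_hom_id y
    rw [hinj.eq_iff]
    refine (Submodule.Quotient.eq _).trans ?_
    constructor
    · rintro ⟨z, hz⟩
      exact ⟨z, congrArg Subtype.val hz⟩
    · rintro ⟨z, hz⟩
      exact ⟨z, Subtype.ext hz⟩

theorem exists_cycles_to_homology_succ (K : CochainComplex (TopModuleCat R) ℕ) (n : ℕ) :
    ∃ π : LinearMap.ker (K.d (n + 1) (n + 2)).hom.toLinearMap → K.homology (n + 1),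
      Function.Surjective π ∧
      ∀ x y, π x = π y ↔ ∃ z, (K.d n (n + 1)).hom z = x.1 - y.1 := by
  obtain ⟨π, h1, h2⟩ := exists_cycles_to_homology (K.sc' n (n + 1) (n + 2))
  let i : (K.sc' n (n + 1) (n + 2)).homology ≅ K.homology (n + 1) :=
    (ShortComplex.homologyMapIso (K.isoSc' n (n + 1) (n + 2) (by simp) (by simp))).symm
  refine ⟨fun x => i.hom.hom (π x), ?_, ?_⟩
  · refine Function.Surjective.comp (g := i.hom.hom) ?_ h1
    intro y
    exact ⟨i.inv.hom y, ConcreteCategory.congr_hom i.inv_hom_id y⟩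
  · intro x y
    have hinj : Function.Injective i.hom.hom :=
      Function.LeftInverse.injective (g := i.inv.hom)
        fun y => ConcreteCategory.congr_hom i.hom_inv_id y
    rw [hinj.eq_iff]
    exact h2 x y

end Homology

/-! ### The coinduced resolution and homogeneous cocycles -/

section Resolution

open TopRep

variable {k : Type*} {G : Type*} [Ring k] [TopologicalSpace k] [Group G] [TopologicalSpace G]
  [IsTopologicalGroup G]

/-- The resolution of a topological representation by coinduced ones is exact. -/
theorem exists_d_eq (A : TopRep k G) (n : ℕ) (x : resolutionX A (n + 1))
    (hx : (d A (n + 1)).hom x = 0) : ∃ y : resolutionX A n, (d A n).hom y = x := by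
  -- Evaluation at `1` is a contracting homotopy: the next differential is `x ↦ const x - d ∘ x`, so
  -- its vanishing at `1` reads `x = d (x 1)`.
  refine ⟨x.toFun 1, ?_⟩
  have h1 : ContinuousMap.const G x - ((d A n).hom : ContinuousMap _ _).comp x = 0 := hx
  have h2 := DFunLike.congr_fun h1 1
  exact (sub_eq_zero.mp h2).symm

theorem d_zero_injective (A : TopRep k G) : Function.Injective (d A 0).hom := by
  intro x y h
  exact DFunLike.congr_fun (show ContinuousMap.const G x = ContinuousMap.const G y from h) 1

theorem d_d_apply (A : TopRep k G) (n : ℕ) (x : resolutionX A n) :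
    (d A (n + 1)).hom ((d A n).hom x) = 0 :=
  ConcreteCategory.congr_hom (d_comp_d A n) x

theorem d_smul (A : TopRep k G) (n : ℕ) (g : G) (x : resolutionX A n) :
    (d A n).hom ((resolutionX A n).ρ g x) = (resolutionX A (n + 1)).ρ g ((d A n).hom x) :=
  (d A n).hom.isIntertwining g x

/-- Continuous cohomology in positive degrees, as homogeneous cocycles modulo coboundaries. -/
theorem exists_cocycles_to_continuousCohomology (A : TopRep k G) (n : ℕ) :
    ∃ π : {x : resolutionX A (n + 2) // (∀ g, (resolutionX A (n + 2)).ρ g x = x) ∧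
        (d A (n + 2)).hom x = 0} → continuousCohomology (n + 1) A,
      Function.Surjective π ∧
      ∀ x y, π x = π y ↔ ∃ z : resolutionX A (n + 1),
        (∀ g, (resolutionX A (n + 1)).ρ g z = z) ∧ (d A (n + 1)).hom z = x.1 - y.1 := by
  obtain ⟨π, h1, h2⟩ := exists_cycles_to_homology_succ (homogeneousCochains A) n
  refine ⟨fun x => π ⟨⟨x.1, x.2.1⟩, ?_⟩, ?_, ?_⟩
  · refine Subtype.ext ?_
    exact (homogeneousCochains.d_apply A (n + 1) _).trans x.2.2
  · intro y
    obtain ⟨x, rfl⟩ := h1 y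
    refine ⟨⟨x.1.1, x.1.2, ?_⟩, rfl⟩
    refine (homogeneousCochains.d_apply A (n + 1) _).symm.trans ?_
    exact congrArg Subtype.val x.2
  · intro x y
    rw [h2]
    constructor
    · rintro ⟨z, hz⟩
      exact ⟨z.1, z.2, (homogeneousCochains.d_apply A n z).symm.trans (congrArg Subtype.val hz)⟩
    · rintro ⟨z, hz, h⟩
      exact ⟨⟨z, hz⟩, Subtype.ext ((homogeneousCochains.d_apply A n ⟨z, hz⟩).trans h)⟩

end Resolution

/-! ### Discrete `p`-primary representations and their coinduced modules -/

section Smooth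

open TopRep

variable {k : Type*} {G : Type*} [Ring k] [TopologicalSpace k] [Group G] [TopologicalSpace G]
  [IsTopologicalGroup G]

/-- A discrete `p`-primary representation on which the group acts through continuous orbit maps. -/
structure IsSmoothPrimary (p : ℕ) (A : TopRep k G) : Prop where
  discrete : DiscreteTopology A
  continuous_orbit : ∀ v : A, Continuous fun g => A.ρ g v
  torsion : ∀ v : A, ∃ n : ℕ, p ^ n • v = 0

theorem continuousMap_discreteTopology {X Y : Type*} [TopologicalSpace X] [CompactSpace X]
    [TopologicalSpace Y] [DiscreteTopology Y] : DiscreteTopology C(X, Y) := by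
  rw [discreteTopology_iff_isOpen_singleton]
  intro f
  have hfin : (Set.range f).Finite := (isCompact_range f.continuous).finite_of_discrete
  -- The image of a compact space in a discrete one is finite, so `f` is pinned down by finitely
  -- many compact-open conditions, one for each fibre.
  have : ({f} : Set C(X, Y)) = ⋂ y ∈ Set.range f, {g : C(X, Y) | Set.MapsTo g (f ⁻¹' {y}) {y}} := by
    ext g
    simp only [Set.mem_singleton_iff, Set.mem_iInter, Set.mem_ofPred_eq]
    constructor
    · rintro rfl y - x hx
      exact hx
    · intro h
      ext x
      exact h (f x) ⟨x, rfl⟩ rfl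
  rw [this]
  exact hfin.isOpen_biInter fun y _ => ContinuousMap.isOpen_setOfPred_mapsTo
    ((isClosed_discrete {y}).preimage f.continuous).isCompact (isOpen_discrete _)

omit [IsTopologicalGroup G] in
/-- For a smooth representation, the action is jointly continuous. -/
theorem IsSmoothPrimary.continuous_smul {p : ℕ} {A : TopRep k G} (hA : IsSmoothPrimary p A)
    {X : Type*} [TopologicalSpace X] {a : X → G} {f : X → A} (ha : Continuous a)
    (hf : Continuous f) : Continuous fun x => A.ρ (a x) (f x) := by
  have := hA.discrete
  rw [continuous_iff_continuousAt]
  intro x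
  have h1 : ContinuousAt (fun y => A.ρ (a y) (f x)) x :=
    ((hA.continuous_orbit (f x)).comp ha).continuousAt
  refine h1.congr ?_
  have h2 : ∀ᶠ y in nhds x, f y = f x :=
    hf.continuousAt.eventually (p := fun z => z = f x) (by simp [nhds_discrete])
  filter_upwards [h2] with y hy
  rw [hy]

omit [IsTopologicalGroup G] in
theorem IsSmoothPrimary.exists_pow_smul_eq_zero [CompactSpace G] {p : ℕ} {A : TopRep k G}
    (hA : IsSmoothPrimary p A) (f : C(G, A)) : ∃ n : ℕ, ∀ x, p ^ n • f x = 0 := by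
  have := hA.discrete
  have hfin : (Set.range f).Finite := (isCompact_range f.continuous).finite_of_discrete
  choose n hn using hA.torsion
  refine ⟨hfin.toFinset.sup n, fun x => ?_⟩
  obtain ⟨c, hc⟩ := Nat.exists_eq_add_of_le
    (Finset.le_sup (f := n) (hfin.mem_toFinset.mpr ⟨x, rfl⟩))
  rw [hc, add_comm, pow_add, mul_smul, hn, smul_zero]

theorem IsSmoothPrimary.coind₁ [CompactSpace G] {p : ℕ} {A : TopRep k G}
    (hA : IsSmoothPrimary p A) : IsSmoothPrimary p A.coind₁ := by
  have := hA.discrete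
  refine ⟨continuousMap_discreteTopology, fun f => ?_, fun f => ?_⟩
  · let F : C(G × G, A) := ⟨fun q => A.ρ q.1 ((f : C(G, A)) (q.1⁻¹ * q.2)),
      hA.continuous_smul continuous_fst
        ((f : C(G, A)).continuous.comp (by fun_prop))⟩
    exact F.curry.continuous
  · obtain ⟨n, hn⟩ := hA.exists_pow_smul_eq_zero f
    exact ⟨n, ContinuousMap.ext hn⟩

theorem IsSmoothPrimary.resolutionX [CompactSpace G] {p : ℕ} {A : TopRep k G}
    (hA : IsSmoothPrimary p A) (n : ℕ) : IsSmoothPrimary p (TopRep.resolutionX A n) := by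
  induction n with
  | zero => exact hA
  | succ n ih => exact ih.coind₁

end Smooth

/-! ### Discrete antiderivatives on `ℤ_p` and surjectivity of `γ - 1` -/

section Procyclic

open TopRep

variable {p : ℕ} [Fact p.Prime]

omit [Fact p.Prime] in
/-- The partial sums of a function on `ℤ / p ^ m` with values killed by `p ^ n` are periodic modulo
`p ^ (m + n)`. -/
theorem sum_range_eq_of_modEq {M : Type*} [AddCommGroup M] {m n : ℕ} (u : ℕ → M)
    (hu : ∀ i j, i ≡ j [MOD p ^ m] → u i = u j) (hn : ∀ i, p ^ n • u i = 0) {a b : ℕ}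
    (hab : a ≡ b [MOD p ^ (m + n)]) :
    ∑ i ∈ Finset.range a, u i = ∑ i ∈ Finset.range b, u i := by
  have hper (a c : ℕ) : ∑ i ∈ Finset.range (a + p ^ m * c), u i =
      ∑ i ∈ Finset.range a, u i + c • ∑ i ∈ Finset.range (p ^ m), u (a + i) := by
    induction c with
    | zero => simp
    | succ c ih =>
      rw [mul_add, mul_one, ← add_assoc, Finset.sum_range_add, ih, add_smul, one_smul, add_assoc]
      congr 2
      refine Finset.sum_congr rfl fun i _ => hu _ _ ?_
      simp [Nat.ModEq, add_right_comm _ _ i]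
  wlog h : a ≤ b generalizing a b
  · exact (this hab.symm (le_of_not_ge h)).symm
  obtain ⟨c, hc⟩ := (Nat.modEq_iff_dvd' h).mp hab
  have hb : b = a + p ^ m * (p ^ n * c) := by
    rw [← mul_assoc, ← pow_add, ← hc]; omega
  rw [hb, hper, mul_comm, mul_smul, Finset.smul_sum, Finset.sum_eq_zero fun i _ => hn _, smul_zero,
    add_zero]

/-- `F ↦ F (· + 1) - F` is surjective on continuous functions on `ℤ_p` with values in a discrete
group of exponent a power of `p`. -/
theorem exists_forward_difference_eq {M : Type*} [AddCommGroup M] [TopologicalSpace M]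
    [DiscreteTopology M] (U : C(ℤ_[p], M)) {n : ℕ} (hn : ∀ x, p ^ n • U x = 0) :
    ∃ F : C(ℤ_[p], M), ∀ x, F (x + 1) - F x = U x := by
  -- By compactness, a Lebesgue number makes `U` uniformly locally constant: it factors through `ℤ /
  -- p ^ m`.
  obtain ⟨m, hm⟩ : ∃ m : ℕ, ∀ x y : ℤ_[p],
      PadicInt.toZModPow m x = PadicInt.toZModPow m y → U x = U y := by
    obtain ⟨δ, hδ, h⟩ := lebesgue_number_lemma_of_metric (isCompact_univ (X := ℤ_[p]))
      (c := fun y => U ⁻¹' {y}) (fun y => (isOpen_discrete _).preimage U.continuous)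
      (fun x _ => Set.mem_iUnion.mpr ⟨U x, rfl⟩)
    obtain ⟨m, hm⟩ := PadicInt.exists_pow_neg_lt p hδ
    refine ⟨m, fun x y hxy => ?_⟩
    obtain ⟨i, hi⟩ := h x trivial
    have hy : y ∈ Metric.ball x δ := by
      rw [Metric.mem_ball, dist_eq_norm]
      refine lt_of_le_of_lt ((PadicInt.norm_le_pow_iff_mem_span_pow _ m).mpr ?_) hm
      rw [← PadicInt.ker_toZModPow, RingHom.mem_ker, map_sub, hxy, sub_self]
    exact (hi (Metric.mem_ball_self hδ)).trans (hi hy).symm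
  -- The antiderivative is the partial sum of `U`. It depends only on `a` modulo `p ^ (m + n)`,
  -- hence extends to a locally constant function on `ℤ_p`.
  let S (a : ℕ) : M := ∑ i ∈ Finset.range a, U i
  have hS {a b : ℕ} (hab : a ≡ b [MOD p ^ (m + n)]) : S a = S b := by
    refine sum_range_eq_of_modEq (fun i : ℕ => U i) (fun i j hij => hm _ _ ?_) (fun i => hn i) hab
    simpa using (ZMod.natCast_eq_natCast_iff i j _).mpr hij
  have : NeZero (p ^ (m + n)) := ⟨pow_ne_zero _ (Fact.out : p.Prime).ne_zero⟩
  have : NeZero (p ^ m) := ⟨pow_ne_zero _ (Fact.out : p.Prime).ne_zero⟩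
  refine ⟨⟨fun x => S (PadicInt.toZModPow (m + n) x).val, ?_⟩, fun x => ?_⟩
  · refine (IsLocallyConstant.iff_exists_open _).mpr (fun x => ?_) |>.continuous
    refine ⟨Metric.ball x ((p : ℝ) ^ (-((m + n : ℕ) : ℤ) + 1)), Metric.isOpen_ball,
      Metric.mem_ball_self (zpow_pos (by exact_mod_cast (Fact.out : p.Prime).pos) _), ?_⟩
    intro y hy
    rw [Metric.mem_ball, dist_eq_norm, ← PadicInt.norm_le_pow_iff_norm_lt_pow_add_one,
      PadicInt.norm_le_pow_iff_mem_span_pow, ← PadicInt.ker_toZModPow, RingHom.mem_ker, map_sub,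
      sub_eq_zero] at hy
    simp only [hy]
  · simp only [ContinuousMap.coe_mk]
    set v := (PadicInt.toZModPow (m + n) x).val with hv
    have h1 : S (PadicInt.toZModPow (m + n) (x + 1)).val = S (v + 1) := by
      refine hS ((ZMod.natCast_eq_natCast_iff _ _ _).mp ?_)
      simp [hv]
    rw [h1]
    simp only [S, Finset.sum_range_succ, add_sub_cancel_left]
    refine hm _ _ ?_
    rw [← PadicInt.cast_toZModPow m (m + n) (by omega) x, map_natCast, hv, ZMod.natCast_val]

variable {k : Type*} {G : Type*} [Ring k] [TopologicalSpace k] [Group G] [TopologicalSpace G]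
  [IsTopologicalGroup G]

omit [IsTopologicalGroup G] in
theorem compactSpace_of_continuousMulEquiv (e : Multiplicative ℤ_[p] ≃ₜ* G) : CompactSpace G :=
  have : CompactSpace (Multiplicative ℤ_[p]) := inferInstanceAs (CompactSpace ℤ_[p])
  e.toHomeomorph.compactSpace

-- The orbit map of `v` is continuous and constant on the natural powers of the generator, which are
-- dense.
omit [IsTopologicalGroup G] in
theorem IsSmoothPrimary.smul_eq_of_generator {A : TopRep k G} (hA : IsSmoothPrimary p A)
    (e : Multiplicative ℤ_[p] ≃ₜ* G) {v : A} (hv : A.ρ (e (.ofAdd 1)) v = v) (g : G) :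
    A.ρ g v = v := by
  have := hA.discrete
  obtain ⟨a, rfl⟩ := e.surjective g
  have hcont : Continuous fun a : ℤ_[p] => A.ρ (e (.ofAdd a)) v :=
    (hA.continuous_orbit v).comp (e.continuous_toFun.comp continuous_ofAdd)
  refine congrFun (PadicInt.denseRange_natCast.equalizer hcont continuous_const ?_) a.toAdd
  ext n
  induction n with
  | zero => simp
  | succ n ih =>
    simp only [Function.comp_apply, Nat.cast_add, Nat.cast_one, ofAdd_add, map_mul] at ih ⊢
    rw [mul_apply_eq_comp, hv, ih]

/-- A topological generator `γ` acts on a coinduced representation with `γ - 1` surjective. -/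
theorem IsSmoothPrimary.exists_generator_sub_eq {A : TopRep k G} (hA : IsSmoothPrimary p A)
    (e : Multiplicative ℤ_[p] ≃ₜ* G) (u : A.coind₁) :
    ∃ h : A.coind₁, A.coind₁.ρ (e (.ofAdd 1)) h - h = u := by
  have := hA.discrete
  have := compactSpace_of_continuousMulEquiv e
  let ι (a : ℤ_[p]) : G := e (.ofAdd a)
  have hι : Continuous ι := e.continuous_toFun.comp continuous_ofAdd
  have hadd (a b : ℤ_[p]) : ι (a + b) = ι a * ι b := by simp [ι, ofAdd_add]
  -- With the ansatz `h (ι a) = ι a • F a`, the equation `γ h - h = u` at `ι (a + 1)` becomes `F (a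
  -- + 1) - F a = -(ι (a + 1))⁻¹ • u (ι (a + 1))`.
  let V : C(ℤ_[p], A) := ⟨fun a => - A.ρ (ι (a + 1))⁻¹ ((u : C(G, A)) (ι (a + 1))),
    (hA.continuous_smul (by fun_prop) (by fun_prop)).neg⟩
  obtain ⟨n, hn⟩ := hA.exists_pow_smul_eq_zero u
  obtain ⟨F, hF⟩ := exists_forward_difference_eq V (n := n) fun x => by
    simp only [V, ContinuousMap.coe_mk, smul_neg, ← map_nsmul, hn, map_zero, neg_zero]
  have hs : Continuous fun g => (e.symm g).toAdd :=
    continuous_toAdd.comp e.symm.continuous_toFun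
  let h : C(G, A) := ⟨fun g => A.ρ g (F (e.symm g).toAdd),
    hA.continuous_smul continuous_id (F.continuous.comp hs)⟩
  refine ⟨h, ContinuousMap.ext fun g => ?_⟩
  obtain ⟨a, rfl⟩ : ∃ a, g = ι (a + 1) := ⟨(e.symm g).toAdd - 1, by simp [ι]⟩
  change A.ρ (ι 1) (h ((ι 1)⁻¹ * ι (a + 1))) - h (ι (a + 1)) = (u : C(G, A)) (ι (a + 1))
  have h1 : (ι 1)⁻¹ * ι (a + 1) = ι a := by
    rw [add_comm, hadd, inv_mul_cancel_left]
  have h2 (b) : h (ι b) = A.ρ (ι b) (F b) := by simp [h, ι]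
  rw [h1, h2, h2, ← mul_apply_eq_comp, ← map_mul, ← hadd, add_comm 1 a, ← map_sub,
    ← neg_sub, hF]
  simp only [V, ContinuousMap.coe_mk, neg_neg]
  rw [← mul_apply_eq_comp, ← map_mul, mul_inv_cancel, map_one,
    one_apply_eq_self]

end Procyclic

/-- A correspondence between `Z` and `U`, total on both sides and compatible with the fibres of `f`
and `g`, descends to a bijection `H ≃ Q`. It allows the diagram chase for `H¹` to proceed without
choosing a map. -/
theorem nat_card_eq_of_relation {Z H U Q : Type*} {f : Z → H} (hf : Function.Surjective f)
    {g : U → Q} (hg : Function.Surjective g) (r : Z → U → Prop) (hr : ∀ z, ∃ u, r z u)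
    (hr' : ∀ u, ∃ z, r z u) (hfg : ∀ z z' u u', r z u → r z' u' → (f z = f z' ↔ g u = g u')) :
    Nat.card H = Nat.card Q := by
  choose φ hφ using hr
  refine Nat.card_congr (Equiv.ofBijective (fun q => g (φ (Function.surjInv hf q))) ⟨?_, ?_⟩)
  · intro q q' hq
    rw [← hfg _ _ _ _ (hφ _) (hφ _)] at hq
    rwa [Function.surjInv_eq hf, Function.surjInv_eq hf] at hq
  · intro y
    obtain ⟨u, rfl⟩ := hg y
    obtain ⟨z, hz⟩ := hr' u
    refine ⟨f z, ?_⟩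
    rw [← hfg _ z _ _ (hφ _) hz, Function.surjInv_eq hf]

theorem nat_card_congr_of_iso {R : Type*} [Ring R] [TopologicalSpace R] {M N : TopModuleCat R}
    (i : M ≅ N) : Nat.card M = Nat.card N :=
  Nat.card_congr ⟨i.hom.hom, i.inv.hom, fun y => ConcreteCategory.congr_hom i.hom_inv_id y,
    fun y => ConcreteCategory.congr_hom i.inv_hom_id y⟩

/-! ### Cohomology of `ℤ_p` in all degrees -/

section ProcyclicCohomology

open TopRep

variable {p : ℕ} [Fact p.Prime] {k : Type*} {G : Type*} [Ring k] [TopologicalSpace k] [Group G]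
  [TopologicalSpace G] [IsTopologicalGroup G]

theorem nat_card_continuousCohomology_zero {A : TopRep k G} (hA : IsSmoothPrimary p A)
    (e : Multiplicative ℤ_[p] ≃ₜ* G) :
    Nat.card (continuousCohomology 0 A) = Nat.card {v : A // A.ρ (e (.ofAdd 1)) v = v} := by
  refine (nat_card_congr_of_iso (ContinuousCohomology.zeroIso A)).trans (Nat.card_congr ?_)
  exact Equiv.subtypeEquivRight fun v => ⟨fun h => h _, fun h g => hA.smul_eq_of_generator e h g⟩

/-- `H¹(G, A) ≃ A / (γ - 1)`, for `G ≃ ℤ_p` with topological generator `γ`. -/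
theorem nat_card_continuousCohomology_one {A : TopRep k G} (hA : IsSmoothPrimary p A)
    (e : Multiplicative ℤ_[p] ≃ₜ* G) :
    Nat.card (continuousCohomology 1 A) =
      Nat.card (A ⧸ ((A.ρ (e (.ofAdd 1))).toLinearMap - LinearMap.id).range) := by
  have := compactSpace_of_continuousMulEquiv e
  set γ := e (.ofAdd 1) with hγ
  obtain ⟨π, hπ, hπ'⟩ := exists_cocycles_to_continuousCohomology A 0
  -- The connecting correspondence: lift the cocycle `f` to `h`; then `γ h - h` is closed since `f`
  -- is invariant, so it comes from some `u` in `A`.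
  let r (f : resolutionX A 2) (u : A) : Prop := ∃ h : resolutionX A 1, (d A 1).hom h = f ∧
    (resolutionX A 1).ρ γ h - h = (d A 0).hom u
  have hr1 (f : {x : resolutionX A 2 // (∀ g, (resolutionX A 2).ρ g x = x) ∧
      (d A 2).hom x = 0}) : ∃ u, r f.1 u := by
    obtain ⟨h, hh⟩ := exists_d_eq A 1 f.1 f.2.2
    obtain ⟨u, hu⟩ := exists_d_eq A 0 ((resolutionX A 1).ρ γ h - h) (by
      rw [map_sub, d_smul, hh, f.2.1, sub_self])
    exact ⟨u, h, hh, hu.symm⟩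
  have hr2 (f f' : resolutionX A 2) (u u' : A) (h1 : r f u) (h2 : r f' u') :
      (∃ z : resolutionX A 1, (∀ g, (resolutionX A 1).ρ g z = z) ∧ (d A 1).hom z = f - f') ↔
        u - u' ∈ ((A.ρ γ).toLinearMap - LinearMap.id).range := by
    obtain ⟨h, rfl, h1⟩ := h1
    obtain ⟨h', rfl, h2⟩ := h2
    constructor
    · rintro ⟨z, hz, hz'⟩
      obtain ⟨v, hv⟩ := exists_d_eq A 0 (h - h' - z) (by
        rw [map_sub, map_sub, hz', sub_self])
      refine ⟨v, d_zero_injective A ?_⟩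
      change (d A 0).hom ((resolutionX A 0).ρ γ v - v) = _
      rw [map_sub, map_sub, ← h1, ← h2, d_smul, hv, map_sub, map_sub, hz]
      abel
    · rintro ⟨v, hv⟩
      replace hv : (resolutionX A 0).ρ γ v - v = u - u' := hv
      refine ⟨h - h' - (d A 0).hom v, (hA.resolutionX 1).smul_eq_of_generator e ?_, ?_⟩
      · rw [← sub_eq_zero]
        have h3 := congrArg (d A 0).hom hv
        rw [map_sub, map_sub, ← h1, ← h2, d_smul] at h3
        rw [map_sub, map_sub, ← hγ, ← sub_eq_zero.mpr h3.symm]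
        abel
      · rw [map_sub, map_sub, d_d_apply, sub_zero]
  refine nat_card_eq_of_relation hπ (Submodule.mkQ_surjective _) (fun f u => r f.1 u) hr1
    (fun u => ?_) fun f f' u u' h h' => ?_
  · obtain ⟨h, hh⟩ := hA.exists_generator_sub_eq e ((d A 0).hom u)
    replace hh : (resolutionX A 1).ρ γ h - h = (d A 0).hom u := hh
    refine ⟨⟨(d A 1).hom h, (hA.resolutionX 2).smul_eq_of_generator e ?_, d_d_apply A 1 h⟩,
      h, rfl, hh⟩
    rw [← hγ, ← sub_eq_zero, ← d_smul, ← map_sub, hh, d_d_apply]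
  · exact (hπ' f f').trans ((hr2 f.1 f'.1 u u' h h').trans (Submodule.Quotient.eq _).symm)

/-- `ℤ_p` has cohomological dimension one for discrete `p`-primary modules. -/
theorem subsingleton_continuousCohomology {A : TopRep k G} (hA : IsSmoothPrimary p A)
    (e : Multiplicative ℤ_[p] ≃ₜ* G) (n : ℕ) :
    Subsingleton (continuousCohomology (n + 2) A) := by
  have := compactSpace_of_continuousMulEquiv e
  obtain ⟨π, hπ, hπ'⟩ := exists_cocycles_to_continuousCohomology A (n + 1)
  refine ⟨fun a b => ?_⟩
  obtain ⟨f, rfl⟩ := hπ a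
  obtain ⟨f', rfl⟩ := hπ b
  rw [hπ']
  have hf : (d A (n + 3)).hom (f.1 - f'.1) = 0 := by rw [map_sub, f.2.2, f'.2.2, sub_zero]
  obtain ⟨h, hh⟩ := exists_d_eq A (n + 2) _ hf
  obtain ⟨u, hu⟩ := exists_d_eq A (n + 1)
    ((resolutionX A (n + 2)).ρ (e (.ofAdd 1)) h - h) (by
      rw [map_sub, d_smul, hh, map_sub, f.2.1, f'.2.1, sub_self])
  obtain ⟨v, hv⟩ := (hA.resolutionX n).exists_generator_sub_eq e u
  replace hv : (resolutionX A (n + 1)).ρ (e (.ofAdd 1)) v - v = u := hv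
  -- The obstruction to invariance of `h` is `d u` with `u = γ v - v`, so subtracting `d v` makes
  -- `h` invariant without changing its differential.
  refine ⟨h - (d A (n + 1)).hom v, (hA.resolutionX (n + 2)).smul_eq_of_generator e ?_, ?_⟩
  · rw [← sub_eq_zero]
    rw [← hv, map_sub, d_smul] at hu
    rw [map_sub, ← sub_eq_zero.mpr hu.symm]
    abel
  · rw [map_sub, d_d_apply, sub_zero, hh]

end ProcyclicCohomology

/-! ### Kernel and cokernel orders of a locally nilpotent endomorphism -/

section Endomorphism

variable {D : Type*} [AddCommGroup D] (f : D →+ D)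

theorem nat_card_ker_eq_index_range [Finite D] : Nat.card f.ker = f.range.index := by
  have h1 := f.ker.card_mul_index
  have h2 := f.range.card_mul_index
  rw [AddSubgroup.index_ker, ← h2, mul_comm] at h1
  exact Nat.eq_of_mul_eq_mul_left Nat.card_pos h1

/-- The image of `t ^ (n + 1)` is the image under `t` of that of `t ^ n`, so its index divides the
product of the indices of the images of `t ^ n` and `t`. -/
theorem index_range_smul_pow_ne_zero {R : Type*} [CommRing R] [Module R D] (t : R)
    (h : (DistribSMul.toAddMonoidHom D t).range.index ≠ 0) (n : ℕ) :
    (DistribSMul.toAddMonoidHom D (t ^ n)).range.index ≠ 0 := by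
  induction n with
  | zero =>
    have : (DistribSMul.toAddMonoidHom D (t ^ 0)).range = ⊤ :=
      AddMonoidHom.range_eq_top.mpr fun x => ⟨x, by simp⟩
    rw [this, AddSubgroup.index_top]
    exact one_ne_zero
  | succ n ih =>
    have : (DistribSMul.toAddMonoidHom D (t ^ (n + 1))).range =
        (DistribSMul.toAddMonoidHom D (t ^ n)).range.map (DistribSMul.toAddMonoidHom D t) := by
      rw [AddMonoidHom.map_range]
      congr 1
      ext x
      simp [pow_succ', mul_smul]
    rw [this, AddSubgroup.index_map]
    refine mul_ne_zero (fun h0 => ih ?_) h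
    exact Nat.eq_zero_of_zero_dvd (h0 ▸ AddSubgroup.index_dvd_of_le le_sup_left)

/-- A locally nilpotent endomorphism that maps a subgroup of finite index onto itself and whose
kernel and cokernel are finite of the same order lives on a finite group. -/
theorem finite_of_nat_card_ker_eq (hnil : ∀ d, ∃ k : ℕ, f^[k] d = 0) (W : AddSubgroup D)
    (hW : W.map f = W) (hindex : W.index ≠ 0)
    (hcard : Nat.card f.ker = f.range.index) (hpos : f.range.index ≠ 0) : Finite D := by
  have hWfin : Finite (D ⧸ W) :=
    have : W.FiniteIndex := ⟨hindex⟩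
    AddSubgroup.finite_quotient_of_finiteIndex
  have hfW (w) (hw : w ∈ W) : f w ∈ W := hW ▸ AddSubgroup.mem_map_of_mem f hw
  have hWf (w) (hw : w ∈ W) : ∃ w' ∈ W, f w' = w := AddSubgroup.mem_map.mp (hW.symm ▸ hw)
  let F : D ⧸ W →+ D ⧸ W := QuotientAddGroup.map W W f hfW
  have hindexF : F.range.index = f.range.index := by
    have : F.range = f.range.map (QuotientAddGroup.mk' W) := by
      ext y
      constructor
      · rintro ⟨y, rfl⟩
        obtain ⟨d, rfl⟩ := QuotientAddGroup.mk'_surjective W y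
        exact ⟨f d, ⟨d, rfl⟩, rfl⟩
      · rintro ⟨_, ⟨d, rfl⟩, rfl⟩
        exact ⟨QuotientAddGroup.mk' W d, rfl⟩
    rw [this, AddSubgroup.index_map_eq _ (QuotientAddGroup.mk'_surjective W)]
    rw [QuotientAddGroup.ker_mk']
    intro w hw
    obtain ⟨w', -, rfl⟩ := hWf w hw
    exact ⟨w', rfl⟩
  let g : f.ker → F.ker := fun d => ⟨QuotientAddGroup.mk' W d, by
    change QuotientAddGroup.mk' W (f d) = 0
    rw [d.2, map_zero]⟩
  -- A lift `d` of a kernel element has `f d ∈ W = f W`, so it can be corrected by an element of `W`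
  -- to lie in the kernel of `f`.
  have hg : Function.Surjective g := by
    rintro ⟨y, hy⟩
    obtain ⟨d, rfl⟩ := QuotientAddGroup.mk'_surjective W y
    obtain ⟨w, hw, hwd⟩ := hWf (f d) ((QuotientAddGroup.eq_zero_iff _).mp hy)
    refine ⟨⟨d - w, by rw [AddMonoidHom.mem_ker, map_sub, hwd, sub_self]⟩, Subtype.ext ?_⟩
    change QuotientAddGroup.mk' W (d - w) = _
    rw [map_sub, show QuotientAddGroup.mk' W w = 0 from (QuotientAddGroup.eq_zero_iff w).mpr hw,
      sub_zero]
  have hinj : Function.Injective g := by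
    have : Finite f.ker := Nat.finite_of_card_ne_zero (hcard ▸ hpos)
    refine ((Nat.bijective_iff_surjective_and_card g).mpr ⟨hg, ?_⟩).1
    rw [hcard, ← hindexF, nat_card_ker_eq_index_range]
  have hbot (w) (hw : w ∈ W) : w = 0 := by
    obtain ⟨k, hk⟩ := hnil w
    induction k generalizing w with
    | zero => exact hk
    | succ k ih =>
      have h0 : f w = 0 := ih (f w) (hfW w hw) hk
      have : (⟨w, h0⟩ : f.ker) = ⟨0, map_zero f⟩ := hinj (Subtype.ext (by
        change QuotientAddGroup.mk' W w = QuotientAddGroup.mk' W 0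
        rw [map_zero]
        exact (QuotientAddGroup.eq_zero_iff w).mpr hw))
      exact congrArg Subtype.val this
  refine Finite.of_injective (QuotientAddGroup.mk' W) ((injective_iff_map_eq_zero _).mpr ?_)
  exact fun d hd => hbot d ((QuotientAddGroup.eq_zero_iff d).mp hd)

end Endomorphism

/-! ### Duality with `ℚ_p / ℤ_p` -/

section PontryaginDual

variable {p : ℕ} [Fact p.Prime]

theorem baer_qpModZp : Module.Baer ℤ_[p] (QpModZp p) := by
  intro I g
  obtain ⟨a, rfl⟩ := (IsPrincipalIdealRing.principal I).principal
  by_cases ha : a = 0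
  · refine ⟨0, fun x hx => ?_⟩
    have hx0 : x = 0 := by simpa [ha] using hx
    subst hx0
    exact (map_zero g).symm
  · obtain ⟨x, hx⟩ := Submodule.Quotient.mk_surjective _ (g ⟨a, Submodule.mem_span_singleton_self a⟩)
    refine ⟨LinearMap.toSpanSingleton ℤ_[p] _ (Submodule.Quotient.mk (x / a)), fun y hy => ?_⟩
    obtain ⟨c, rfl⟩ := Submodule.mem_span_singleton.mp hy
    have h1 : (⟨c • a, hy⟩ : Submodule.span ℤ_[p] {a}) =
        c • ⟨a, Submodule.mem_span_singleton_self a⟩ := rfl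
    rw [h1, map_smul g, ← hx, LinearMap.toSpanSingleton_apply, ← Submodule.Quotient.mk_smul,
      ← Submodule.Quotient.mk_smul]
    congr 1
    have ha' : (a : ℚ_[p]) ≠ 0 := fun h => ha (Subtype.ext h)
    rw [smul_assoc]
    congr 1
    change (a : ℚ_[p]) * (x / a) = x
    field_simp

theorem mk_inv_ne_zero : (Submodule.Quotient.mk ((p : ℚ_[p])⁻¹) : QpModZp p) ≠ 0 := by
  rw [Ne, Submodule.Quotient.mk_eq_zero]
  rintro ⟨z, hz⟩
  have h1 : ‖(p : ℚ_[p])⁻¹‖ ≤ 1 := by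
    rw [← hz]
    exact z.norm_le_one
  rw [norm_inv, Padic.norm_p, inv_inv] at h1
  exact absurd h1 (not_le.mpr (by exact_mod_cast (Fact.out : p.Prime).one_lt))

variable {M : Type*} [AddCommGroup M] [Module ℤ_[p] M]

/-- Characters separate points. -/
theorem exists_dual_apply_ne_zero {x : M} (hx : x ≠ 0) : ∃ φ : M →ₗ[ℤ_[p]] QpModZp p, φ x ≠ 0 := by
  -- The class of `1 / p` is killed by the maximal ideal, which contains the annihilator of any `x ≠
  -- 0`. So `x ↦ q` is a character of the span of `x`, and injectivity of `ℚ_p / ℤ_p` extends it to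
  -- `M`.
  let q : QpModZp p := Submodule.Quotient.mk ((p : ℚ_[p])⁻¹)
  have hle : Ideal.torsionOf ℤ_[p] M x ≤ LinearMap.ker (LinearMap.toSpanSingleton ℤ_[p] _ q) := by
    have hne : Ideal.torsionOf ℤ_[p] M x ≠ ⊤ := by
      rwa [Ne, Ideal.torsionOf_eq_top_iff]
    refine (IsLocalRing.le_maximalIdeal hne).trans ?_
    rw [PadicInt.maximalIdeal_eq_span_p, Ideal.span_le, Set.singleton_subset_iff]
    change (p : ℤ_[p]) • q = 0
    rw [← Submodule.Quotient.mk_smul, Submodule.Quotient.mk_eq_zero]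
    refine ⟨1, ?_⟩
    have : (p : ℚ_[p]) ≠ 0 := by exact_mod_cast (Fact.out : p.Prime).ne_zero
    rw [Algebra.smul_def, map_natCast, Algebra.linearMap_apply, map_one, mul_inv_cancel₀ this]
  let φ₀ := Submodule.liftQ _ _ hle ∘ₗ
    (Ideal.quotTorsionOfEquivSpanSingleton ℤ_[p] M x).symm.toLinearMap
  obtain ⟨φ, hφ⟩ := baer_qpModZp.extension_property (Submodule.span ℤ_[p] {x}).subtype
    (Submodule.injective_subtype _) φ₀
  refine ⟨φ, ?_⟩
  have h1 := LinearMap.congr_fun hφ ⟨x, Submodule.mem_span_singleton_self x⟩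
  have h2 : (Ideal.quotTorsionOfEquivSpanSingleton ℤ_[p] M x).symm
      ⟨x, Submodule.mem_span_singleton_self x⟩ = Submodule.Quotient.mk 1 := by
    rw [LinearEquiv.symm_apply_eq]
    exact Subtype.ext (one_smul ℤ_[p] x).symm
  have h3 : φ x = q := by
    refine h1.trans ?_
    change Submodule.liftQ _ _ hle ((Ideal.quotTorsionOfEquivSpanSingleton ℤ_[p] M x).symm _) = q
    rw [h2, Submodule.liftQ_apply, LinearMap.toSpanSingleton_apply, one_smul]
  rw [h3]
  exact mk_inv_ne_zero

theorem finite_setOf_pow_smul_eq_zero (k : ℕ) :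
    {y : QpModZp p | (p : ℤ_[p]) ^ k • y = 0}.Finite := by
  refine ((Finset.range (p ^ k)).finite_toSet.image fun a : ℕ =>
    (Submodule.Quotient.mk ((a : ℚ_[p]) / (p : ℚ_[p]) ^ k) : QpModZp p)).subset ?_
  intro y hy
  obtain ⟨x, rfl⟩ := Submodule.Quotient.mk_surjective _ y
  obtain ⟨z, hz⟩ := (Submodule.Quotient.mk_eq_zero _).mp
    ((Submodule.Quotient.mk_smul _ _ _).trans (hy : (p : ℤ_[p]) ^ k • Submodule.Quotient.mk x = _))
  have hp : (p : ℚ_[p]) ^ k ≠ 0 :=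
    pow_ne_zero _ (by exact_mod_cast (Fact.out : p.Prime).ne_zero)
  refine ⟨z.appr k, by simpa using z.appr_lt k, ?_⟩
  obtain ⟨c, hc⟩ := Ideal.mem_span_singleton.mp (z.appr_spec k)
  refine (Submodule.Quotient.eq _).mpr ⟨-c, ?_⟩
  rw [Algebra.smul_def, map_pow, map_natCast] at hz
  have hc' := congrArg (algebraMap ℤ_[p] ℚ_[p]) hc
  rw [map_sub, map_mul, map_pow, map_natCast, map_natCast] at hc'
  rw [Algebra.linearMap_apply] at hz ⊢
  rw [map_neg]
  field_simp
  linear_combination hc' - hz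

theorem exists_pow_smul_eq_zero_of_finite [Finite M] : ∃ k : ℕ, ∀ x : M, (p : ℤ_[p]) ^ k • x = 0 := by
  have hN : (Nat.card M : ℤ_[p]) ≠ 0 := by exact_mod_cast Nat.card_pos.ne'
  refine ⟨(Nat.card M : ℤ_[p]).valuation, fun x => ?_⟩
  have h1 : (Nat.card M : ℤ_[p]) • x = 0 := by
    rw [Nat.cast_smul_eq_nsmul, card_nsmul_eq_zero']
  rw [PadicInt.unitCoeff_spec hN, mul_smul] at h1
  exact (smul_eq_zero_iff_eq (PadicInt.unitCoeff hN)).mp h1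

/-- A power `p ^ k` kills `M`, so all characters take values in the finite `p ^ k`-torsion of `ℚ_p /
ℤ_p`. -/
theorem finite_dual [Finite M] : Finite (Dual p M) := by
  obtain ⟨k, hk⟩ := exists_pow_smul_eq_zero_of_finite (p := p) (M := M)
  have := (finite_setOf_pow_smul_eq_zero (p := p) k).to_subtype
  refine Finite.of_injective (β := M → {y : QpModZp p | (p : ℤ_[p]) ^ k • y = 0})
    (fun φ x => ⟨(show M →ₗ[ℤ_[p]] QpModZp p from φ) x, ?_⟩) fun φ ψ h => LinearMap.ext fun x => ?_
  · change (p : ℤ_[p]) ^ k • (show M →ₗ[ℤ_[p]] QpModZp p from φ) x = 0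
    rw [← map_smul, hk, map_zero]
  · exact congrArg Subtype.val (congrFun h x)

/-- Because characters separate points, `M` embeds in its double dual, which is finite. -/
theorem finite_of_finite_dual [Finite (Dual p M)] : Finite M := by
  have := finite_dual (p := p) (M := Dual p M)
  let ev (x : M) : Dual p (Dual p M) :=
    { toFun φ := (show M →ₗ[ℤ_[p]] QpModZp p from φ) x
      map_add' _ _ := rfl
      map_smul' r φ := map_smul (show M →ₗ[ℤ_[p]] QpModZp p from φ) r x }
  refine Finite.of_injective ev fun x y h => ?_
  by_contra hxy
  obtain ⟨φ, hφ⟩ := exists_dual_apply_ne_zero (p := p) (sub_ne_zero.mpr hxy)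
  rw [map_sub, sub_ne_zero] at hφ
  exact hφ (LinearMap.congr_fun h φ)

theorem finite_dual_iff : Finite (Dual p M) ↔ Finite M :=
  ⟨fun _ => finite_of_finite_dual (p := p), fun _ => finite_dual⟩

/-- On a cofinitely generated module over a Noetherian ring, the images of the powers of an element
stabilise. -/
theorem exists_pow_smul_eq_pow_succ_smul {R : Type*} [CommRing R] [IsNoetherianRing R]
    [Algebra ℤ_[p] R] [Module R M] [IsScalarTower ℤ_[p] R M] [Module.Finite R (Dual p M)] (t : R) :
    ∃ n : ℕ, ∀ x : M, ∃ y : M, t ^ n • x = t ^ (n + 1) • y := by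
  have : IsNoetherian R (Dual p M) := isNoetherian_of_isNoetherianRing_of_finite R _
  let K : ℕ →o Submodule R (Dual p M) :=
    ⟨fun n => LinearMap.ker (LinearMap.lsmul R (Dual p M) (t ^ n)), monotone_nat_of_le_succ
      fun n φ hφ => by
        rw [LinearMap.mem_ker, LinearMap.lsmul_apply] at hφ ⊢
        rw [pow_succ', mul_smul, hφ, smul_zero]⟩
  obtain ⟨n, hn⟩ := monotone_stabilizes_iff_noetherian.mpr this K
  refine ⟨n, fun x => ?_⟩
  by_contra hx
  -- A character that kills `t ^ (n + 1) M` but not `t ^ n • x` would lie in the kernel of `t ^ (n +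
  -- 1)` on the dual and not in that of `t ^ n`, although these agree.
  let W : Submodule ℤ_[p] M := LinearMap.range (Algebra.lsmul ℤ_[p] ℤ_[p] M (t ^ (n + 1)))
  have hxW : (Submodule.Quotient.mk (t ^ n • x) : M ⧸ W) ≠ 0 := by
    rw [Ne, Submodule.Quotient.mk_eq_zero]
    rintro ⟨y, hy⟩
    exact hx ⟨y, hy.symm⟩
  obtain ⟨φ, hφ⟩ := exists_dual_apply_ne_zero (p := p) hxW
  let ψ : Dual p M := φ ∘ₗ W.mkQ
  have h1 : ψ ∈ K (n + 1) := LinearMap.ext fun y => by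
    change φ (Submodule.Quotient.mk (t ^ (n + 1) • y)) = 0
    rw [show (Submodule.Quotient.mk (t ^ (n + 1) • y) : M ⧸ W) = 0 from
      (Submodule.Quotient.mk_eq_zero W).mpr ⟨y, rfl⟩, map_zero]
  rw [← hn (n + 1) n.le_succ] at h1
  exact hφ (LinearMap.congr_fun (h1 : t ^ n • ψ = 0) x)

end PontryaginDual

/-! ### Finite elementary modules are zero -/

section Elementary

open PowerSeries

variable {O : Type*} [CommRing O]

theorem C_dvd_iff {a : O} {g : O⟦X⟧} : C a ∣ g ↔ ∀ n, a ∣ coeff n g := by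
  constructor
  · rintro ⟨h, rfl⟩ n
    exact ⟨coeff n h, coeff_C_mul _ _ _⟩
  · intro h
    choose c hc using h
    exact ⟨mk c, PowerSeries.ext fun n => by rw [coeff_C_mul, coeff_mk, hc]⟩

/-- Coefficientwise reduction modulo `ϖ` has kernel `(ϖ)` and maps to power series over the domain
`O / ϖ`. -/
theorem prime_C {ϖ : O} (hϖ : Prime ϖ) : Prime (C ϖ : O⟦X⟧) := by
  have hI : (Ideal.span {ϖ}).IsPrime := (Ideal.span_singleton_prime hϖ.ne_zero).mpr hϖ
  have hker (g : O⟦X⟧) : C ϖ ∣ g ↔ PowerSeries.map (Ideal.Quotient.mk (Ideal.span {ϖ})) g = 0 := by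
    rw [C_dvd_iff, PowerSeries.ext_iff]
    simp [Ideal.Quotient.eq_zero_iff_mem, Ideal.mem_span_singleton]
  refine ⟨fun h => hϖ.ne_zero (C_injective (by rw [h, map_zero])), fun h => hϖ.not_isUnit ?_,
    fun a b h => ?_⟩
  · simpa using h.map (constantCoeff (R := O))
  · rw [hker, map_mul, mul_eq_zero] at h
    rwa [hker, hker]

theorem infinite_quotient_C_pow {ϖ : O} (hϖ : Prime ϖ) {m : ℕ} (hm : m ≠ 0) :
    Infinite (O⟦X⟧ ⧸ Ideal.span {(C ϖ : O⟦X⟧) ^ m}) := by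
  refine Infinite.of_injective (fun n : ℕ => Ideal.Quotient.mk _ (X ^ n)) fun i j h => ?_
  by_contra hij
  rw [Ideal.Quotient.eq, Ideal.mem_span_singleton] at h
  have h1 := C_dvd_iff.mp ((dvd_pow_self _ hm).trans h) i
  rw [map_sub, coeff_X_pow, coeff_X_pow, if_pos rfl, if_neg hij, sub_zero] at h1
  exact hϖ.not_isUnit (isUnit_of_dvd_one h1)

variable [IsDomain O] [IsLocalRing O]

omit [IsDomain O] in
theorem natDegree_pos_of_irreducible {f : O[X]}
    (hf : f.IsDistinguishedAt (IsLocalRing.maximalIdeal O))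
    (hirr : Irreducible f) : 0 < f.natDegree := by
  refine Nat.pos_of_ne_zero fun h => hirr.not_isUnit ?_
  rw [hf.monic.natDegree_eq_zero.mp h]
  exact isUnit_one

/-- The powers of `ϖ` are pairwise incongruent modulo `f`: a difference of two is a unit times a
power of `ϖ`, whose divisors are powers of `ϖ` up to units, whereas `f` is neither a unit nor
divisible by `ϖ`. -/
theorem infinite_quotient_distinguished_pow {ϖ : O} (hϖ : Prime ϖ) {f : O[X]}
    (hf : f.IsDistinguishedAt (IsLocalRing.maximalIdeal O)) (hdeg : 0 < f.natDegree)
    {m : ℕ} (hm : m ≠ 0) : Infinite (O⟦X⟧ ⧸ Ideal.span {(f : O⟦X⟧) ^ m}) := by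
  have hnd : ¬ C ϖ ∣ (f : O⟦X⟧) := fun h => by
    have h1 := C_dvd_iff.mp h f.natDegree
    rw [Polynomial.coeff_coe, hf.monic.coeff_natDegree] at h1
    exact hϖ.not_isUnit (isUnit_of_dvd_one h1)
  have hnu : ¬ IsUnit (f : O⟦X⟧) := fun h => by
    have h1 := h.map (constantCoeff (R := O))
    rw [← coeff_zero_eq_constantCoeff_apply, Polynomial.coeff_coe] at h1
    exact (IsLocalRing.mem_maximalIdeal _).mp (hf.mem hdeg) h1
  have key (i j : ℕ) (hij : i < j) : ¬ (f : O⟦X⟧) ∣ C ϖ ^ j - C ϖ ^ i := fun h => by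
    have hu : IsUnit ((C ϖ : O⟦X⟧) ^ (j - i) - 1) := by
      rw [isUnit_iff_constantCoeff, map_sub, map_pow, constantCoeff_C, map_one, ← neg_sub,
        IsUnit.neg_iff]
      refine IsLocalRing.isUnit_one_sub_self_of_mem_nonunits _ fun h => hϖ.not_isUnit ?_
      exact (isUnit_pow_iff (Nat.sub_ne_zero_of_lt hij)).mp h
    have h1 : (C ϖ : O⟦X⟧) ^ j - C ϖ ^ i = C ϖ ^ i * (C ϖ ^ (j - i) - 1) := by
      rw [mul_sub, ← pow_add, Nat.add_sub_of_le hij.le, mul_one]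
    rw [h1, hu.dvd_mul_right] at h
    obtain ⟨k, -, hk⟩ := (dvd_prime_pow (prime_C hϖ) i).mp h
    rcases k with _ | k
    · exact hnu (hk.symm.isUnit (by simp))
    · exact hnd ((dvd_pow_self _ k.succ_ne_zero).trans hk.symm.dvd)
  refine Infinite.of_injective (fun n : ℕ => Ideal.Quotient.mk _ (C ϖ ^ n)) fun i j h => ?_
  rcases lt_trichotomy i j with hij | hij | hij
  · rw [eq_comm, Ideal.Quotient.eq, Ideal.mem_span_singleton] at h
    exact absurd ((dvd_pow_self _ hm).trans h) (key i j hij)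
  · exact hij
  · rw [Ideal.Quotient.eq, Ideal.mem_span_singleton] at h
    exact absurd ((dvd_pow_self _ hm).trans h) (key j i hij)

/-- An elementary module is finite only if both of its invariants vanish. -/
theorem ElementaryData.sum_eq_zero_of_finite {ϖ : O} (hϖ : Prime ϖ) (E : ElementaryData O)
    [Finite (E.Mod ϖ)] : E.muSum = 0 ∧ E.lamSum = 0 := by
  have h1 : Finite (∀ i : Fin E.s, O⟦X⟧ ⧸ Ideal.span {(C ϖ : O⟦X⟧) ^ E.mu i}) :=
    Finite.of_surjective (Prod.fst : E.Mod ϖ → _) Prod.fst_surjective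
  have h2 : Finite (∀ j : Fin E.t, O⟦X⟧ ⧸ Ideal.span {(E.f j : O⟦X⟧) ^ E.lam j}) :=
    Finite.of_surjective (Prod.snd : E.Mod ϖ → _) Prod.snd_surjective
  constructor
  · refine Finset.sum_eq_zero fun i _ => ?_
    by_contra hi
    have := infinite_quotient_C_pow hϖ hi
    exact this.not_finite (h1.of_surjective _ (Function.surjective_eval i))
  · refine Finset.sum_eq_zero fun j _ => ?_
    by_contra hj
    have := infinite_quotient_distinguished_pow hϖ (E.distinguished j)
      (natDegree_pos_of_irreducible (E.distinguished j) (E.irreducible j)) (left_ne_zero_of_mul hj)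
    exact this.not_finite (h2.of_surjective _ (Function.surjective_eval j))

omit [IsDomain O] in
theorem ElementaryData.subsingleton_mod (ϖ : O) (E : ElementaryData O) (hmu : E.muSum = 0)
    (hlam : E.lamSum = 0) : Subsingleton (E.Mod ϖ) := by
  have h1 (i) : Subsingleton (O⟦X⟧ ⧸ Ideal.span {(C ϖ : O⟦X⟧) ^ E.mu i}) := by
    have hi : E.mu i = 0 := Finset.sum_eq_zero_iff.mp hmu i (Finset.mem_univ i)
    rw [Ideal.Quotient.subsingleton_iff, hi, pow_zero, Ideal.span_singleton_one]
  have h2 (j) : Subsingleton (O⟦X⟧ ⧸ Ideal.span {(E.f j : O⟦X⟧) ^ E.lam j}) := by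
    have hj : E.lam j = 0 := by
      refine (mul_eq_zero.mp (Finset.sum_eq_zero_iff.mp hlam j (Finset.mem_univ j))).resolve_right ?_
      exact (natDegree_pos_of_irreducible (E.distinguished j) (E.irreducible j)).ne'
    rw [Ideal.Quotient.subsingleton_iff, hj, pow_zero, Ideal.span_singleton_one]
  infer_instance

/-- Both invariants of a module vanish if and only if the module is finite. -/
theorem muInvariant_eq_zero_and_lambdaInvariant_eq_zero_iff {ϖ : O} (hϖ : Prime ϖ) (M : Type*)
    [AddCommGroup M] [Module O⟦X⟧ M] :
    muInvariant ϖ M = 0 ∧ lambdaInvariant ϖ M = 0 ↔ Finite M := by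
  constructor
  · rintro ⟨hmu, hlam⟩
    by_cases h : ∃ E, IsStructure ϖ M E
    · rw [muInvariant, dif_pos h, Nat.cast_eq_zero] at hmu
      rw [lambdaInvariant, dif_pos h, Nat.cast_eq_zero] at hlam
      have := h.choose.subsingleton_mod ϖ hmu hlam
      obtain ⟨φ, hker, -⟩ := h.choose_spec
      exact Finite.of_injective (fun x => (⟨x, Subsingleton.elim _ _⟩ : LinearMap.ker φ))
        fun x y hxy => congrArg Subtype.val hxy
    · rw [muInvariant, dif_neg h] at hmu
      exact absurd hmu ENat.top_ne_zero
  · intro hM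
    have h : ∃ E, IsStructure ϖ M E := by
      let E : ElementaryData O := ⟨0, 0, Fin.elim0, Fin.elim0, Fin.elim0, fun j => j.elim0,
        fun j => j.elim0⟩
      have : Subsingleton (E.Mod ϖ) := E.subsingleton_mod ϖ rfl rfl
      exact ⟨E, 0, inferInstance, inferInstance⟩
    -- The chosen elementary module need not be the zero one just exhibited; it is finite because
    -- `φ` has finite image and finite cokernel. Both invariants are read off this same choice.
    obtain ⟨φ, -, hcoker⟩ := h.choose_spec
    have h1 : Finite φ.range := Finite.of_surjective _ φ.surjective_rangeRestrict
    have : Finite (h.choose.Mod ϖ) := by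
      have := φ.range.toAddSubgroup.card_mul_index
      refine Nat.finite_of_card_ne_zero ?_
      rw [← this]
      exact mul_ne_zero Nat.card_pos.ne' (Nat.card_pos (α := _ ⧸ φ.range)).ne'
    rw [muInvariant, dif_pos h, lambdaInvariant, dif_pos h, Nat.cast_eq_zero, Nat.cast_eq_zero]
    exact h.choose.sum_eq_zero_of_finite hϖ

end Elementary

/-! ### The action of `Γ` on `D` and the formula for `χ` -/

section Action

variable {p : ℕ} [Fact p.Prime]

-- Each `p`-th power gains a factor in `I`: in `y ^ p - 1 = (∑ y ^ i) * (y - 1)` the sum is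
-- congruent to `p` modulo `I`.
omit [Fact p.Prime] in
theorem pow_prime_pow_sub_one_mem {R : Type*} [CommRing R] {I : Ideal R} (hp : (p : R) ∈ I) {x : R}
    (hx : x - 1 ∈ I) (N : ℕ) : x ^ p ^ N - 1 ∈ I ^ (N + 1) := by
  induction N with
  | zero => simpa using hx
  | succ N ih =>
    set y := x ^ p ^ N
    have hy : y - 1 ∈ I := Ideal.pow_le_self N.succ_ne_zero ih
    have h1 : ∑ i ∈ Finset.range p, y ^ i ∈ I := by
      have h2 : ∑ i ∈ Finset.range p, (y ^ i - 1) ∈ I :=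
        Ideal.sum_mem _ fun i _ => I.mem_of_dvd (sub_one_dvd_pow_sub_one y i) hy
      have h3 : ∑ i ∈ Finset.range p, y ^ i = ∑ i ∈ Finset.range p, (y ^ i - 1) + p := by simp
      rw [h3]
      exact I.add_mem h2 hp
    rw [pow_succ p, pow_mul, ← geom_sum_mul, pow_succ' _ (N + 1)]
    exact Ideal.mul_mem_mul h1 ih

variable (O : Type w) [CommRing O] [Algebra ℤ_[p] O]
  {Γ : Type v} [Group Γ] [TopologicalSpace Γ] [IsTopologicalGroup Γ]

omit [IsTopologicalGroup Γ] in
theorem gammaHom_generator (e : Multiplicative ℤ_[p] ≃ₜ* Γ) :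
    gammaHom O e (e (.ofAdd 1)) = 1 + PowerSeries.X := by
  have := PowerSeries.binomialSeries_nat (R := ℤ_[p]) (A := O) 1
  simpa [gammaHom] using this

variable (D : Type (max u v)) [AddCommGroup D] [Module O⟦X⟧ D] [TopologicalSpace D]
  [DiscreteTopology D]

omit [IsTopologicalGroup Γ] in
theorem gammaRep_apply (e : Multiplicative ℤ_[p] ≃ₜ* Γ) (g : Γ) (d : D) :
    (gammaRep.{u} O D e).ρ g d = gammaHom O e g • d := rfl

variable {O D}

omit [IsTopologicalGroup Γ] in
theorem isSmoothPrimary_gammaRep [IsLocalRing O] (hD : IsDiscretePrimary p O D)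
    (e : Multiplicative ℤ_[p] ≃ₜ* Γ) : IsSmoothPrimary p (gammaRep.{u} O D e) := by
  refine ⟨‹DiscreteTopology D›, fun (d : D) => ?_, hD.2⟩
  by_cases hp : IsUnit (p : O⟦X⟧)
  · obtain ⟨n, hn⟩ := hD.2 d
    have hd : d = 0 := by
      rw [← Nat.cast_smul_eq_nsmul O⟦X⟧, Nat.cast_pow] at hn
      exact (hp.pow n).smul_eq_zero.mp hn
    subst hd
    exact continuous_const.congr fun g => (map_zero ((gammaRep.{u} O D e).ρ g)).symm
  obtain ⟨n, hn⟩ := hD.1 d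
  -- The subgroup `p ^ n ℤ_p` fixes `d`, since `γ ^ (p ^ n a) - 1` lies in a power of the maximal
  -- ideal that kills `d`. This makes the orbit map locally constant.
  have hstab (a : ℤ_[p]) : gammaHom O e (e (.ofAdd (p ^ n * a))) • d = d := by
    have h1 : gammaHom O e (e (.ofAdd (p ^ n * a))) = gammaHom O e (e (.ofAdd a)) ^ p ^ n := by
      rw [← map_pow, ← map_pow, ← ofAdd_nsmul, nsmul_eq_mul, Nat.cast_pow]
    have h2 : gammaHom O e (e (.ofAdd a)) - 1 ∈ IsLocalRing.maximalIdeal O⟦X⟧ := by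
      rw [IsLocalRing.mem_maximalIdeal, mem_nonunits_iff, PowerSeries.isUnit_iff_constantCoeff]
      simp [gammaHom]
    rw [← sub_eq_zero, h1]
    nth_rw 2 [← one_smul O⟦X⟧ d]
    rw [← sub_smul]
    exact hn _ (Ideal.pow_le_pow_right n.le_succ (pow_prime_pow_sub_one_mem hp h2 n))
  have hcont : Continuous fun a : ℤ_[p] => gammaHom O e (e (.ofAdd a)) • d := by
    refine (IsLocallyConstant.iff_exists_open _).mpr (fun x => ?_) |>.continuous
    refine ⟨Metric.ball x ((p : ℝ) ^ (-(n : ℤ) + 1)), Metric.isOpen_ball,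
      Metric.mem_ball_self (zpow_pos (by exact_mod_cast (Fact.out : p.Prime).pos) _), ?_⟩
    intro y hy
    rw [Metric.mem_ball, dist_eq_norm, ← PadicInt.norm_le_pow_iff_norm_lt_pow_add_one,
      PadicInt.norm_le_pow_iff_mem_span_pow, Ideal.mem_span_singleton] at hy
    obtain ⟨a, ha⟩ := hy
    rw [eq_add_of_sub_eq' ha, ofAdd_add, map_mul, map_mul, mul_smul, hstab]
  have h3 := hcont.comp (continuous_toAdd.comp e.symm.continuous_toFun)
  refine h3.congr fun g => ?_
  change gammaHom O e (e (e.symm g)) • d = _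
  rw [ContinuousMulEquiv.apply_symm_apply]
  rfl

theorem eulerChar_eq [IsLocalRing O] (hD : IsDiscretePrimary p O D)
    (e : Multiplicative ℤ_[p] ≃ₜ* Γ) :
    eulerChar.{u} O D e =
      (Nat.card (DistribSMul.toAddMonoidHom D (PowerSeries.X : O⟦X⟧)).ker : ℚ) /
        ((DistribSMul.toAddMonoidHom D (PowerSeries.X : O⟦X⟧)).range.index : ℚ) := by
  have hA := isSmoothPrimary_gammaRep hD e
  have hγ (d : D) : (gammaRep.{u} O D e).ρ (e (.ofAdd 1)) d = d + (PowerSeries.X : O⟦X⟧) • d := by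
    rw [gammaRep_apply, gammaHom_generator, add_smul, one_smul]
  have h0 : Nat.card (gammaCohomology.{u} O D e 0) =
      Nat.card (DistribSMul.toAddMonoidHom D (PowerSeries.X : O⟦X⟧)).ker := by
    rw [nat_card_continuousCohomology_zero hA e]
    refine Nat.card_congr (Equiv.subtypeEquivRight fun (d : D) => ?_)
    rw [hγ]
    exact add_eq_left
  have h1 : Nat.card (gammaCohomology.{u} O D e 1) =
      (DistribSMul.toAddMonoidHom D (PowerSeries.X : O⟦X⟧)).range.index := by
    rw [nat_card_continuousCohomology_one hA e]
    refine congrArg AddSubgroup.index (?_ : Submodule.toAddSubgroup _ = _)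
    ext x
    refine exists_congr fun (d : D) => ?_
    exact Eq.congr_left (z := x) (sub_eq_of_eq_add' (hγ d))
  have h2 (n : ℕ) : Nat.card (gammaCohomology.{u} O D e (n + 2)) = 1 := by
    have := subsingleton_continuousCohomology hA e n
    exact Nat.card_unique
  rw [eulerChar, finprod_eq_prod_of_mulSupport_subset (s := Finset.range 2)]
  · rw [Finset.prod_range_succ, Finset.prod_range_one, h0, h1]
    simp [div_eq_mul_inv]
  · intro i hi
    rw [Finset.coe_range, Set.mem_Iio]
    by_contra h
    obtain ⟨n, rfl⟩ := Nat.exists_eq_add_of_le' (not_lt.mp h)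
    exact hi (by simp only [h2, Nat.cast_one, one_zpow])

end Action

/-- The Euler characteristic of a cofinitely generated module is one if and only if the module is
finite. -/
theorem eulerChar_eq_one_iff_finite {p : ℕ} [Fact p.Prime] {O : Type w} [CommRing O]
    [IsLocalRing O] [IsNoetherianRing O] [Algebra ℤ_[p] O]
    {Γ : Type v} [Group Γ] [TopologicalSpace Γ] [IsTopologicalGroup Γ]
    {D : Type (max u v)} [AddCommGroup D] [TopologicalSpace D] [DiscreteTopology D]
    [Module O⟦X⟧ D] [Module ℤ_[p] D] [IsScalarTower ℤ_[p] O⟦X⟧ D]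
    (hD : IsDiscretePrimary p O D) (hfg : IsCofinitelyGenerated p O D)
    (e : Multiplicative ℤ_[p] ≃ₜ* Γ) :
    eulerChar.{u} O D e = 1 ↔ Finite D := by
  rw [eulerChar_eq hD]
  set f := DistribSMul.toAddMonoidHom D (PowerSeries.X : O⟦X⟧) with hf
  constructor
  · intro h
    -- An infinite cokernel has index `0`, and division by zero would give `χ = 0`; hence `χ = 1`
    -- already forces a finite cokernel.
    have hpos : f.range.index ≠ 0 := fun h0 => by simp [h0] at h
    have hcard : Nat.card f.ker = f.range.index := by
      exact_mod_cast eq_of_div_eq_one h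
    have : Module.Finite O⟦X⟧ (Dual p D) := hfg
    obtain ⟨n, hn⟩ := exists_pow_smul_eq_pow_succ_smul (p := p) (M := D) (PowerSeries.X : O⟦X⟧)
    refine finite_of_nat_card_ker_eq f (fun d => ?_)
      (DistribSMul.toAddMonoidHom D ((PowerSeries.X : O⟦X⟧) ^ n)).range ?_
      (index_range_smul_pow_ne_zero _ hpos n) hcard hpos
    · obtain ⟨k, hk⟩ := hD.1 d
      refine ⟨k, ?_⟩
      have h1 : f^[k] d = (PowerSeries.X : O⟦X⟧) ^ k • d := smul_iterate_apply _ _ _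
      rw [h1]
      refine hk _ (Ideal.pow_mem_pow ?_ k)
      rw [IsLocalRing.mem_maximalIdeal]
      rw [mem_nonunits_iff, PowerSeries.isUnit_iff_constantCoeff, PowerSeries.constantCoeff_X]
      exact not_isUnit_zero
    · ext x
      constructor
      · rintro ⟨_, ⟨d, rfl⟩, rfl⟩
        exact ⟨(PowerSeries.X : O⟦X⟧) • d, smul_comm _ _ _⟩
      · rintro ⟨d, rfl⟩
        obtain ⟨d', hd'⟩ := hn d
        refine ⟨_, ⟨d', rfl⟩, ?_⟩
        rw [pow_succ', mul_smul] at hd'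
        exact hd'.symm
  · intro hfin
    have hindex : f.range.index ≠ 0 := AddSubgroup.FiniteIndex.index_ne_zero
    rw [nat_card_ker_eq_index_range, div_self (by exact_mod_cast hindex)]

end Iwasawa

theorem corollary3p4 (p : ℕ) [Fact p.Prime]
    (O : Type w) [CommRing O] [IsDomain O] [IsDiscreteValuationRing O]
    [Algebra ℤ_[p] O] [Module.Finite ℤ_[p] O] (ϖ : O) (hϖ : Irreducible ϖ)
    (Γ : Type v) [Group Γ] [TopologicalSpace Γ] [IsTopologicalGroup Γ]
    (e : Multiplicative ℤ_[p] ≃ₜ* Γ)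
    (D : Type (max u v)) [AddCommGroup D] [TopologicalSpace D] [DiscreteTopology D]
    [Module (PowerSeries O) D] [Module ℤ_[p] D] [IsScalarTower ℤ_[p] (PowerSeries O) D]
    (hD : Iwasawa.IsDiscretePrimary p O D)
    (hfg : Iwasawa.IsCofinitelyGenerated p O D)
    (htors : Iwasawa.IsCotorsion p O D)
    (hχ : Iwasawa.EulerCharWellDefined.{u} O D e) :
    Iwasawa.eulerChar.{u} O D e = 1 ↔
      Iwasawa.muInvariant ϖ (Iwasawa.Dual p D) = 0 ∧
        Iwasawa.lambdaInvariant ϖ (Iwasawa.Dual p D) = 0 := by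
  rw [Iwasawa.eulerChar_eq_one_iff_finite hD hfg,
    Iwasawa.muInvariant_eq_zero_and_lambdaInvariant_eq_zero_iff hϖ.prime, Iwasawa.finite_dual_iff]
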